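/- Let $q_1,q_2>1$ be integers. Let $B_1(x)=x-\lfloor x\rfloor-\tfrac12$ for $x\in\mathbb R\setminus\mathbb Z$ and $B_1(x)=0$ for $x\in\mathbb Z$. For primitive Dirichlet characters $\chi_1$ modulo $q_1$ and $\chi_2$ modulo $q_2$ with $\chi_1(-1)\chi_2(-1)=1$, the newform Dedekind sum $S_{\chi_1,\chi_2}:\Gamma_0(q_1q_2)\to\mathbb C$ is given, for $\gamma=\begin{pmatrix}a&b\\c&d\end{pmatrix}$ with $c>0$, by $$S_{\chi_1,\chi_2}(\gamma)=\sum_{j \bmod c}\ \sum_{n\bmod q_1}\overline{\chi_2}(j)\,\overline{\chi_1}(n)\,B_1\!\left(\frac jc\right)B_1\!\left(\frac n{q_1}+\frac{aj}c\right),$$ and by $S_{\chi_1,\chi_2}(\gamma)=S_{\chi_1,\chi_2}(-\gamma)$ if $c<0$ and $S_{\chi_1,\chi_2}(\gamma)=0$ if $c=0$. Let $\mathrm{Ded}(q_1,q_2)$ be the set of all these functions $S_{\chi_1,\chi_2}$, and let $F=\mathbb Q(\zeta_{\varphi(q_1)},\zeta_{\varphi(q_2)})\subset\mathbb C$, where $\zeta_n=e^{2\pi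 i/n}$ and $\varphi$ is Euler's function. All Dirichlet characters modulo $q_1$ or $q_2$ take values in $F$; for such a $\chi$ and $\sigma\in\mathrm{Gal}(F/\mathbb Q)$, let $\chi^\sigma$ be the character $n\mapsto\sigma(\chi(n))$. Then every $S\in\mathrm{Ded}(q_1,q_2)$ takes values in $F$, and there is a group action of $\mathrm{Gal}(F/\mathbb Q)$ on $\mathrm{Ded}(q_1,q_2)$, $(\sigma,S)\mapsto S^\sigma$, given by $S^\sigma(\gamma)=\sigma(S(\gamma))$ for all $\gamma\in\Gamma_0(q_1q_2)$. For all $\sigma$ and all $\chi_1,\chi_2$ as above, $\chi_1^\sigma$ and $\chi_2^\sigma$ are again primitive with $\chi_1^\sigma(-1)\chi_2^\sigma(-1)=1$, and $$S_{\chi_1,\chi_2}^\sigma=S_{\chi_1^\sigma,\chi_2^\sigma}.$$ Consequently, if $S,S'\in\mathrm{Ded}(q_1,q_2)$ lie in the same orbit of this action, then they have the same kernel: $\{\gamma\in\Gamma_0(q_1q_2):S(\gamma)=0\}=\{\gamma\in\Gamma_0(q_1q_2):S'(\gamma)=0\}$. -/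

import Mathlib

open CongruenceSubgroup
open scoped MatrixGroups

noncomputable section

/-- The first Bernoulli function: `x - ⌊x⌋ - 1/2` for non-integral `x`, and `0` at integers. -/
def bernoulliB1 (x : ℝ) : ℝ :=
  if Int.fract x = 0 then 0 else x - ⌊x⌋ - 1 / 2

/-- The finite double sum
`∑_{j mod c} ∑_{n mod q₁} conj(χ₂(j)) conj(χ₁(n)) B₁(j/c) B₁(n/q₁ + aj/c)`.
The summand is periodic in `j` modulo `c` when `q₂ ∣ c`, and periodic in `n` modulo `q₁`. -/
def dedekindDoubleSum {q₁ q₂ : ℕ} (χ₁ : DirichletCharacter ℂ q₁) (χ₂ : DirichletCharacter ℂ q₂)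
    (a : ℤ) (c : ℕ) : ℂ :=
  ∑ j ∈ Finset.range c, ∑ n ∈ Finset.range q₁,
    starRingEnd ℂ (χ₂ (j : ZMod q₂)) * starRingEnd ℂ (χ₁ (n : ZMod q₁)) *
      (bernoulliB1 ((j : ℝ) / (c : ℝ)) : ℂ) *
      (bernoulliB1 ((n : ℝ) / (q₁ : ℝ) + (a : ℝ) * (j : ℝ) / (c : ℝ)) : ℂ)

/-- The newform Dedekind sum `S_{χ₁,χ₂} : Γ₀(q₁q₂) → ℂ`. For a matrix with first column `(a, c)` it
is the finite double sum at `(a, c)` if `c > 0`, the finite double sum at `(-a, -c)` if `c < 0`,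
and `0` if `c = 0`. -/
def newformDedekindSum {q₁ q₂ : ℕ} (χ₁ : DirichletCharacter ℂ q₁)
    (χ₂ : DirichletCharacter ℂ q₂) (γ : Gamma0 (q₁ * q₂)) : ℂ :=
  if 0 < (γ : SL(2, ℤ)) 1 0 then
    dedekindDoubleSum χ₁ χ₂ ((γ : SL(2, ℤ)) 0 0) ((γ : SL(2, ℤ)) 1 0).toNat
  else if (γ : SL(2, ℤ)) 1 0 < 0 then
    dedekindDoubleSum χ₁ χ₂ (-(γ : SL(2, ℤ)) 0 0) (-(γ : SL(2, ℤ)) 1 0).toNat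
  else 0

/-- The pairs `(χ₁, χ₂)` to which a newform Dedekind sum is attached: both characters are
primitive, and `χ₁χ₂(-1) = 1`. -/
def IsDedekindPair {q₁ q₂ : ℕ} (χ₁ : DirichletCharacter ℂ q₁)
    (χ₂ : DirichletCharacter ℂ q₂) : Prop :=
  χ₁.IsPrimitive ∧ χ₂.IsPrimitive ∧ χ₁ (-1) * χ₂ (-1) = 1

/-- The set `Ded(q₁, q₂)` of newform Dedekind sums, as functions on `Γ₀(q₁q₂)`. -/
def Ded (q₁ q₂ : ℕ) : Set (Gamma0 (q₁ * q₂) → ℂ) :=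
  {S | ∃ (χ₁ : DirichletCharacter ℂ q₁) (χ₂ : DirichletCharacter ℂ q₂),
    IsDedekindPair χ₁ χ₂ ∧ S = newformDedekindSum χ₁ χ₂}

/-- The kernel `{γ ∈ Γ₀(q₁q₂) : S(γ) = 0}`. -/
def dedekindKernel {q₁ q₂ : ℕ} (S : Gamma0 (q₁ * q₂) → ℂ) : Set (Gamma0 (q₁ * q₂)) :=
  {γ | S γ = 0}

/-- `ζ_n = e^{2πi/n}`. -/
def zetaRoot (n : ℕ) : ℂ := Complex.exp (2 * Real.pi * Complex.I / n)

/-- The field `F = ℚ(ζ_{φ(q₁)}, ζ_{φ(q₂)})`, as a subfield of `ℂ`. -/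
def dedekindField (q₁ q₂ : ℕ) : IntermediateField ℚ ℂ :=
  IntermediateField.adjoin ℚ {zetaRoot q₁.totient, zetaRoot q₂.totient}

/-- `χ^σ`, that is `n ↦ σ(χ(n))`, for a Dirichlet character `χ` with values in a subfield `F`
of `ℂ` and an automorphism `σ` of `F`. -/
def galoisConj {F : IntermediateField ℚ ℂ} (σ : Gal(F/ℚ)) {q : ℕ} (χ : DirichletCharacter ℂ q)
    (hχ : ∀ n, χ n ∈ F) : DirichletCharacter ℂ q where
  toFun n := (σ ⟨χ n, hχ n⟩ : ℂ)
  map_one' := by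
    have h : (⟨χ 1, hχ 1⟩ : F) = 1 := Subtype.ext (map_one χ)
    rw [h, map_one]
    rfl
  map_mul' m n := by
    have h : (⟨χ (m * n), hχ (m * n)⟩ : F) = ⟨χ m, hχ m⟩ * ⟨χ n, hχ n⟩ :=
      Subtype.ext (map_mul χ m n)
    rw [h, map_mul]
    rfl
  map_nonunit' n hn := by
    have h : (⟨χ n, hχ n⟩ : F) = 0 := Subtype.ext (χ.map_nonunit hn)
    rw [h, map_zero]
    rfl

theorem dirichletCharacter_apply_mem {F : IntermediateField ℚ ℂ} {q : ℕ} (hq : q ≠ 0)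
    (hF : zetaRoot q.totient ∈ F) (χ : DirichletCharacter ℂ q) (n : ZMod q) : χ n ∈ F := by
  by_cases hn : IsUnit n
  · obtain ⟨u, rfl⟩ := hn
    have h1 : χ (u : ZMod q) ^ q.totient = 1 := by
      rw [← map_pow, ← Units.val_pow_eq_pow_val, ZMod.pow_totient]
      simp
    have h0 : q.totient ≠ 0 := (Nat.totient_pos.2 (Nat.pos_of_ne_zero hq)).ne'
    have : NeZero q.totient := ⟨h0⟩
    obtain ⟨i, -, hi⟩ := (Complex.isPrimitiveRoot_exp q.totient h0).eq_pow_of_pow_eq_one h1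
    rw [← hi]
    exact pow_mem hF i
  · rw [χ.map_nonunit hn]
    exact zero_mem F

theorem apply_mem_dedekindField_left {q₁ q₂ : ℕ} (hq₁ : 1 < q₁) (χ₁ : DirichletCharacter ℂ q₁)
    (n : ZMod q₁) : χ₁ n ∈ dedekindField q₁ q₂ :=
  dirichletCharacter_apply_mem (by omega)
    (IntermediateField.subset_adjoin ℚ _ (Set.mem_insert _ _)) χ₁ n

theorem apply_mem_dedekindField_right {q₁ q₂ : ℕ} (hq₂ : 1 < q₂) (χ₂ : DirichletCharacter ℂ q₂)
    (n : ZMod q₂) : χ₂ n ∈ dedekindField q₁ q₂ :=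
  dirichletCharacter_apply_mem (by omega)
    (IntermediateField.subset_adjoin ℚ _ (Set.mem_insert_of_mem _ (Set.mem_singleton _))) χ₂ n

end

/-! The double sum has rational coefficients, since `bernoulliB1` is rational at rational points,
and its character values enter through conjugates, which are inverses. It is thus computed inside
`F` by field operations, and σ acts on it by replacing each χ with χ^σ
(`exists_eq_dedekindDoubleSum`). Injectivity of σ preserves primitivity
(`galoisConj_isPrimitive_iff`) and the vanishing of values, hence kernels. -/

/-- Values at units have norm 1; at non-units the convention `0⁻¹ = 0` applies. Unlike conjugation,
inversion commutes with every σ for free. -/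
theorem DirichletCharacter.starRingEnd_apply_eq_inv {q : ℕ} [NeZero q] (χ : DirichletCharacter ℂ q)
    (n : ZMod q) : starRingEnd ℂ (χ n) = (χ n)⁻¹ := by
  by_cases hn : IsUnit n
  · obtain ⟨u, rfl⟩ := hn
    rw [Complex.inv_def, Complex.normSq_eq_norm_sq, χ.unit_norm_eq_one u]
    simp
  · simp [χ.map_nonunit hn]

theorem exists_rat_bernoulliB1 (x : ℚ) : ∃ r : ℚ, bernoulliB1 (x : ℝ) = r := by
  unfold bernoulliB1
  split_ifs
  · exact ⟨0, by simp⟩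
  · exact ⟨x - ⌊x⌋ - 1 / 2, by push_cast; simp⟩

section GaloisConj

variable {F : IntermediateField ℚ ℂ} (σ : Gal(F/ℚ))

theorem galoisConj_apply {q : ℕ} (χ : DirichletCharacter ℂ q) (hχ : ∀ n, χ n ∈ F) (n : ZMod q) :
    galoisConj σ χ hχ n = (σ ⟨χ n, hχ n⟩ : ℂ) := rfl

theorem galoisConj_apply_eq_one_iff {q : ℕ} (χ : DirichletCharacter ℂ q) (hχ : ∀ n, χ n ∈ F)
    (n : ZMod q) : galoisConj σ χ hχ n = 1 ↔ χ n = 1 := by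
  rw [galoisConj_apply, OneMemClass.coe_eq_one, EmbeddingLike.map_eq_one_iff,
    ← OneMemClass.coe_eq_one]

/-- For `d ∣ q`, factoring through `d` depends only on the kernel on units, which an injective σ
does not change. -/
theorem galoisConj_factorsThrough_iff {q : ℕ} [NeZero q] (χ : DirichletCharacter ℂ q)
    (hχ : ∀ n, χ n ∈ F) (d : ℕ) : (galoisConj σ χ hχ).FactorsThrough d ↔ χ.FactorsThrough d := by
  by_cases hd : d ∣ q
  · rw [DirichletCharacter.factorsThrough_iff_ker_unitsMap hd,
      DirichletCharacter.factorsThrough_iff_ker_unitsMap hd]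
    have h : (galoisConj σ χ hχ).toUnitHom.ker = χ.toUnitHom.ker := by
      ext u
      simp only [MonoidHom.mem_ker, Units.ext_iff, MulChar.coe_toUnitHom, Units.val_one,
        galoisConj_apply_eq_one_iff]
    rw [h]
  · exact ⟨fun h => absurd h.dvd hd, fun h => absurd h.dvd hd⟩

theorem galoisConj_isPrimitive_iff {q : ℕ} [NeZero q] (χ : DirichletCharacter ℂ q)
    (hχ : ∀ n, χ n ∈ F) : (galoisConj σ χ hχ).IsPrimitive ↔ χ.IsPrimitive := by
  have h : (galoisConj σ χ hχ).conductorSet = χ.conductorSet :=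
    Set.ext fun d => galoisConj_factorsThrough_iff σ χ hχ d
  rw [DirichletCharacter.isPrimitive_def, DirichletCharacter.isPrimitive_def,
    DirichletCharacter.conductor, DirichletCharacter.conductor, h]

theorem IsDedekindPair.galoisConj {q₁ q₂ : ℕ} [NeZero q₁] [NeZero q₂]
    {χ₁ : DirichletCharacter ℂ q₁} {χ₂ : DirichletCharacter ℂ q₂} (h : IsDedekindPair χ₁ χ₂)
    (hχ₁ : ∀ n, χ₁ n ∈ F) (hχ₂ : ∀ n, χ₂ n ∈ F) :
    IsDedekindPair (galoisConj σ χ₁ hχ₁) (galoisConj σ χ₂ hχ₂) := by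
  refine ⟨(galoisConj_isPrimitive_iff σ χ₁ hχ₁).2 h.1,
    (galoisConj_isPrimitive_iff σ χ₂ hχ₂).2 h.2.1, ?_⟩
  have h1 : (⟨χ₁ (-1), hχ₁ _⟩ * ⟨χ₂ (-1), hχ₂ _⟩ : F) = 1 := Subtype.ext h.2.2
  rw [galoisConj_apply, galoisConj_apply, ← MulMemClass.coe_mul, ← map_mul, h1, map_one,
    OneMemClass.coe_one]

/-- A single `x`, chosen before σ, yields both membership in `F` and the Galois formula. -/
theorem exists_eq_dedekindDoubleSum {q₁ q₂ : ℕ} [NeZero q₁] [NeZero q₂]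
    (χ₁ : DirichletCharacter ℂ q₁) (χ₂ : DirichletCharacter ℂ q₂) (hχ₁ : ∀ n, χ₁ n ∈ F) (hχ₂ : ∀ n, χ₂ n ∈ F) (a : ℤ) (c : ℕ) :
    ∃ x : F, (x : ℂ) = dedekindDoubleSum χ₁ χ₂ a c ∧ ∀ σ : Gal(F/ℚ),
      (σ x : ℂ) = dedekindDoubleSum (galoisConj σ χ₁ hχ₁) (galoisConj σ χ₂ hχ₂) a c := by
  choose B hB using exists_rat_bernoulliB1
  have hB₁ (j : ℕ) : bernoulliB1 ((j : ℝ) / c) = B ((j : ℚ) / c) := by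
    rw [← hB]
    push_cast
    rfl
  have hB₂ (j n : ℕ) : bernoulliB1 ((n : ℝ) / q₁ + (a : ℝ) * j / c) =
      B ((n : ℚ) / q₁ + (a : ℚ) * j / c) := by
    rw [← hB]
    push_cast
    rfl
  -- The same sum formed inside `F`; the values of `B` are rational, so every σ fixes them.
  refine ⟨∑ j ∈ Finset.range c, ∑ n ∈ Finset.range q₁,
    (⟨χ₂ j, hχ₂ j⟩ : F)⁻¹ * (⟨χ₁ n, hχ₁ n⟩ : F)⁻¹ * (B ((j : ℚ) / c) : F) *
      (B ((n : ℚ) / q₁ + (a : ℚ) * j / c) : F), ?_, fun σ => ?_⟩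
  · simp only [dedekindDoubleSum, DirichletCharacter.starRingEnd_apply_eq_inv, hB₁, hB₂]
    push_cast
    rfl
  · simp only [dedekindDoubleSum, DirichletCharacter.starRingEnd_apply_eq_inv, hB₁, hB₂]
    simp only [galoisConj_apply, map_sum, map_mul, map_inv₀, map_ratCast]
    push_cast
    rfl

theorem exists_eq_newformDedekindSum {q₁ q₂ : ℕ} [NeZero q₁] [NeZero q₂]
    (χ₁ : DirichletCharacter ℂ q₁) (χ₂ : DirichletCharacter ℂ q₂) (hχ₁ : ∀ n, χ₁ n ∈ F) (hχ₂ : ∀ n, χ₂ n ∈ F)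
    (γ : Gamma0 (q₁ * q₂)) :
    ∃ x : F, (x : ℂ) = newformDedekindSum χ₁ χ₂ γ ∧ ∀ σ : Gal(F/ℚ),
      (σ x : ℂ) = newformDedekindSum (galoisConj σ χ₁ hχ₁) (galoisConj σ χ₂ hχ₂) γ := by
  unfold newformDedekindSum
  split_ifs
  · exact exists_eq_dedekindDoubleSum χ₁ χ₂ hχ₁ hχ₂ _ _
  · exact exists_eq_dedekindDoubleSum χ₁ χ₂ hχ₁ hχ₂ _ _
  · exact ⟨0, by simp⟩

theorem newformDedekindSum_mem {q₁ q₂ : ℕ} [NeZero q₁] [NeZero q₂]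
    (χ₁ : DirichletCharacter ℂ q₁) (χ₂ : DirichletCharacter ℂ q₂) (hχ₁ : ∀ n, χ₁ n ∈ F) (hχ₂ : ∀ n, χ₂ n ∈ F)
    (γ : Gamma0 (q₁ * q₂)) : newformDedekindSum χ₁ χ₂ γ ∈ F := by
  obtain ⟨x, hx, -⟩ := exists_eq_newformDedekindSum χ₁ χ₂ hχ₁ hχ₂ γ
  exact hx ▸ x.2

theorem apply_newformDedekindSum {q₁ q₂ : ℕ} [NeZero q₁] [NeZero q₂]
    (χ₁ : DirichletCharacter ℂ q₁) (χ₂ : DirichletCharacter ℂ q₂) (hχ₁ : ∀ n, χ₁ n ∈ F) (hχ₂ : ∀ n, χ₂ n ∈ F)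
    (γ : Gamma0 (q₁ * q₂)) (h : newformDedekindSum χ₁ χ₂ γ ∈ F) :
    (σ ⟨newformDedekindSum χ₁ χ₂ γ, h⟩ : ℂ) =
      newformDedekindSum (galoisConj σ χ₁ hχ₁) (galoisConj σ χ₂ hχ₂) γ := by
  obtain ⟨x, hx, hσ⟩ := exists_eq_newformDedekindSum χ₁ χ₂ hχ₁ hχ₂ γ
  rw [← hσ σ, show (⟨newformDedekindSum χ₁ χ₂ γ, h⟩ : F) = x from Subtype.ext hx.symm]

end GaloisConj

theorem apply_mem_dedekindField_of_mem_Ded {q₁ q₂ : ℕ} (hq₁ : 1 < q₁) (hq₂ : 1 < q₂)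
    {S : Gamma0 (q₁ * q₂) → ℂ} (hS : S ∈ Ded q₁ q₂) (γ : Gamma0 (q₁ * q₂)) :
    S γ ∈ dedekindField q₁ q₂ := by
  have : NeZero q₁ := ⟨by omega⟩
  have : NeZero q₂ := ⟨by omega⟩
  obtain ⟨χ₁, χ₂, -, rfl⟩ := hS
  exact newformDedekindSum_mem χ₁ χ₂ (apply_mem_dedekindField_left hq₁ χ₁)
    (apply_mem_dedekindField_right hq₂ χ₂) γ

/-- Since σ acts on values, the action is well defined even if S does not determine its pair of
characters. -/
theorem galois_apply_mem_Ded {q₁ q₂ : ℕ} (hq₁ : 1 < q₁) (hq₂ : 1 < q₂)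
    (σ : Gal(dedekindField q₁ q₂/ℚ)) {S : Gamma0 (q₁ * q₂) → ℂ} (hS : S ∈ Ded q₁ q₂) :
    (fun γ => (σ ⟨S γ, apply_mem_dedekindField_of_mem_Ded hq₁ hq₂ hS γ⟩ : ℂ)) ∈ Ded q₁ q₂ := by
  have : NeZero q₁ := ⟨by omega⟩
  have : NeZero q₂ := ⟨by omega⟩
  obtain ⟨χ₁, χ₂, h, rfl⟩ := id hS
  exact ⟨_, _, h.galoisConj σ (apply_mem_dedekindField_left hq₁ χ₁)
    (apply_mem_dedekindField_right hq₂ χ₂), funext fun γ => apply_newformDedekindSum σ _ _ _ _ γ _⟩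

/-- The action of `Gal(F/ℚ)` on `Ded(q₁, q₂)` given by `S^σ(γ) = σ(S(γ))`. -/
@[reducible]
noncomputable def dedGaloisAction {q₁ q₂ : ℕ} (hq₁ : 1 < q₁) (hq₂ : 1 < q₂) :
    MulAction Gal(dedekindField q₁ q₂/ℚ) (Ded q₁ q₂) where
  smul σ S := ⟨_, galois_apply_mem_Ded hq₁ hq₂ σ S.2⟩
  one_smul _ := rfl
  mul_smul _ _ _ := rfl

theorem proposition4p1 (q₁ q₂ : ℕ) (hq₁ : 1 < q₁) (hq₂ : 1 < q₂) :
    -- every newform Dedekind sum takes values in `F`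
    ∃ hF : ∀ S ∈ Ded q₁ q₂, ∀ γ, S γ ∈ dedekindField q₁ q₂,
    -- there is a group action of `Gal(F/ℚ)` on `Ded(q₁, q₂)` ...
    ∃ _ : MulAction Gal(dedekindField q₁ q₂/ℚ) (Ded q₁ q₂),
      -- ... given by `S^σ(γ) = σ(S(γ))`
      (∀ (σ : Gal(dedekindField q₁ q₂/ℚ)) (S : Ded q₁ q₂) (γ : Gamma0 (q₁ * q₂)),
        (σ • S).1 γ = (σ ⟨S.1 γ, hF S.1 S.2 γ⟩ : ℂ)) ∧
      -- ... which sends `S_{χ₁,χ₂}` to `S_{χ₁^σ,χ₂^σ}`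
      (∀ (σ : Gal(dedekindField q₁ q₂/ℚ)) (χ₁ : DirichletCharacter ℂ q₁)
        (χ₂ : DirichletCharacter ℂ q₂) (h : IsDedekindPair χ₁ χ₂),
        IsDedekindPair (galoisConj σ χ₁ (apply_mem_dedekindField_left hq₁ χ₁))
          (galoisConj σ χ₂ (apply_mem_dedekindField_right hq₂ χ₂)) ∧
        (σ • (⟨newformDedekindSum χ₁ χ₂, χ₁, χ₂, h, rfl⟩ : Ded q₁ q₂)).1 =
          newformDedekindSum (galoisConj σ χ₁ (apply_mem_dedekindField_left hq₁ χ₁))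
            (galoisConj σ χ₂ (apply_mem_dedekindField_right hq₂ χ₂))) ∧
      -- Dedekind sums in the same orbit have the same kernel
      (∀ S S' : Ded q₁ q₂, S' ∈ MulAction.orbit Gal(dedekindField q₁ q₂/ℚ) S →
        dedekindKernel S'.1 = dedekindKernel S.1) := by
  have : NeZero q₁ := ⟨by omega⟩
  have : NeZero q₂ := ⟨by omega⟩
  refine ⟨fun S hS γ => apply_mem_dedekindField_of_mem_Ded hq₁ hq₂ hS γ,
    dedGaloisAction hq₁ hq₂, fun _ _ _ => rfl, fun σ χ₁ χ₂ h => ⟨h.galoisConj σ _ _,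
      funext fun γ => apply_newformDedekindSum σ χ₁ χ₂ _ _ γ _⟩, ?_⟩
  -- A point of the orbit is `σ • S`, and σ sends only 0 to 0.
  rintro S _ ⟨σ, rfl⟩
  ext γ
  change (σ ⟨S.1 γ, _⟩ : ℂ) = 0 ↔ S.1 γ = 0
  rw [ZeroMemClass.coe_eq_zero, EmbeddingLike.map_eq_zero_iff, ← ZeroMemClass.coe_eq_zero]
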